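/- Consider $\mathbb C$ as a first-order structure in the language of rings, and let $\operatorname{acl}(\emptyset)$ be its model-theoretic algebraic closure of the empty set (the field of algebraic numbers). For $A\subseteq\mathbb C$ and $n\in\mathbb N$, let $\mathcal C_n(\overline{\mathbb C}_A)$ be the first-order structure with universe $\mathbb C$ whose basic relations are all subsets of $\mathbb C^k$, $k\le n$, that are definable in the field $\mathbb C$ with parameters from $A$ and have $\operatorname{acl}$-dimension at most $1$. For every natural number $n\ge 3$ there is an $(n+1)$-ary relation on $\mathbb C$ that is definable without parameters in $\mathcal C_2(\overline{\mathbb C}_{\operatorname{acl}(\emptyset)})$ but is not definable in $\mathcal C_{n-1}(\overline{\mathbb C}_{\mathbb C})$ by any quantifier-free formula, even with parameters from $\mathbb C$. Consequently, for every $n\ge 2$, the structure $\mathcal C_n(\overline{\mathbb C}_{\mathbb C})$ does not have quantifier elimination. -/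

import Mathlib

universe u

/-- The model-theoretic algebraic closure `acl(A)` of a set `A` of elements of the structure `M`:
the union of the finite sets definable with parameters from `A`. -/
def acl (L : FirstOrder.Language.{u, u}) {M : Type u} [L.Structure M] (A : Set M) : Set M :=
  {b | ∃ s : Set M, A.Definable₁ L s ∧ s.Finite ∧ b ∈ s}

/-- `HasIndependentPoint L X d`: for some formula `φ` with parameters from `M` (the variables
indexed by `M` stand for the parameters) that defines `X` in `M`, some elementary extension `N`
of `M` has a tuple `(a_1, …, a_k)` satisfying `φ`, with a subtuple
`(a_{i_1}, …, a_{i_d})`, `i_1 < ⋯ < i_d`, none of whose entries is algebraic over `M` and the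
preceding entries of the subtuple. -/
def HasIndependentPoint (L : FirstOrder.Language.{u, u}) {M : Type u} [L.Structure M] {k : ℕ}
    (X : Set (Fin k → M)) (d : ℕ) : Prop :=
  ∃ φ : L.Formula (M ⊕ Fin k), X = {v | φ.Realize (Sum.elim id v)} ∧
    ∃ (N : Type u) (_ : L.Structure N) (f : L.ElementaryEmbedding M N) (a : Fin k → N),
      φ.Realize (Sum.elim f a) ∧
      ∃ i : Fin d ↪o Fin k,
        ∀ j : Fin d, a (i j) ∉ acl L (Set.range f ∪ {x | ∃ l : Fin d, l < j ∧ x = a (i l)})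

/-- The `acl`-dimension of a definable subset `X` of `M ^ k`, for `M` a geometric structure
(such as an algebraically closed field). The dimension of the empty set is `⊥`, that is `-∞`. -/
noncomputable def aclDim (L : FirstOrder.Language.{u, u}) {M : Type u} [L.Structure M] {k : ℕ}
    (X : Set (Fin k → M)) : WithBot ℕ∞ :=
  sSup {e | ∃ d : ℕ, HasIndependentPoint L X d ∧ e = ((d : ℕ∞) : WithBot ℕ∞)}

/-- `X ⊆ M ^ k` is an `A`-definable `k`-curve: it is definable with parameters from `A` and has
dimension at most one. -/
def IsCurve (L : FirstOrder.Language.{u, u}) {M : Type u} [L.Structure M] (A : Set M) {k : ℕ}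
    (X : Set (Fin k → M)) : Prop :=
  A.Definable L X ∧ aclDim L X ≤ 1

/-- The relational language of `𝒞_n(M_A)`: a `k`-ary relation symbol for each `A`-definable
`k`-curve, for each `k ≤ n`, and no function symbols. -/
def curveLanguage (L : FirstOrder.Language.{u, u}) {M : Type u} [L.Structure M] (A : Set M) (n : ℕ) :
    FirstOrder.Language.{0, u} where
  Functions _ := Empty
  Relations k := {X : Set (Fin k → M) // k ≤ n ∧ IsCurve L A X}

/-- The structure `𝒞_n(M_A)` on the set `M`: each relation symbol is interpreted by the curve
that it names. -/
instance curveStructure (L : FirstOrder.Language.{u, u}) {M : Type u} [L.Structure M] (A : Set M) (n : ℕ) :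
    (curveLanguage L A n).Structure M where
  funMap f := f.elim
  RelMap r v := v ∈ r.1

/-- `s ⊆ M ^ α` is defined in the structure `M` by a quantifier-free formula with parameters
from `A` (the variables indexed by `A` stand for the parameters). -/
def QFDefinable {M : Type*} (A : Set M) (L : FirstOrder.Language) [L.Structure M] {α : Type*}
    (s : Set (α → M)) : Prop :=
  ∃ φ : L.Formula (A ⊕ α), φ.IsQF ∧ s = {v | φ.Realize (Sum.elim (fun x : A => (x : M)) v)}

/-- The structure `M` has quantifier elimination: each formula is equivalent in `M` to a
quantifier-free formula in the same free variables. -/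
def HasQuantifierElimination (L : FirstOrder.Language) (M : Type*) [L.Structure M] : Prop :=
  ∀ (k : ℕ) (φ : L.Formula (Fin k)), ∃ ψ : L.Formula (Fin k), ψ.IsQF ∧
    ∀ v : Fin k → M, φ.Realize v ↔ ψ.Realize v

/-- The field of complex numbers as a first-order structure in the language of rings. -/
noncomputable instance complexCompatibleRing : FirstOrder.Ring.CompatibleRing ℂ :=
  FirstOrder.Ring.compatibleRingOfRing ℂ

/-- The language of `𝒞_n(ℂ_ℂ)`: a predicate for each subset of `ℂ ^ k`, `k ≤ n`, of dimension at
most one that is definable in the field `ℂ` with parameters from `ℂ`. -/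
noncomputable abbrev complexCurves (n : ℕ) : FirstOrder.Language :=
  curveLanguage FirstOrder.Language.ring (Set.univ : Set ℂ) n

/-- The language of `𝒞_n(ℂ_{acl(∅)})`: a predicate for each subset of `ℂ ^ k`, `k ≤ n`, of
dimension at most one that is definable in the field `ℂ` with parameters from `acl(∅)`. -/
noncomputable abbrev algebraicCurves (n : ℕ) : FirstOrder.Language :=
  curveLanguage FirstOrder.Language.ring (acl FirstOrder.Language.ring (∅ : Set ℂ)) n

/-! The witness is `cyclicRootProducts n`: tuples `(t, x_0, …, x_{n-1})` with `x_i = s_i s_{i+1}`,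
indices cyclic, for square roots `s_i` of `t - i`. It is definable from binary curves because `s_i²
- s_{i+1}²` is a nonzero constant: the sum `w = s_i + s_{i+1}` determines both roots and their
product (`exists_sum_eq_mul_iff`), so each condition is the graph of a partial function.

A quantifier-free formula of `𝒞_{n-1}` involves finitely many parameters, and each atom sees at most
`n - 1` coordinates. Take `t` transcendental over a field `k` containing the parameters, and negate
`x_0`. Every atom misses some `x_j`, and Kummer theory gives an automorphism over `k(t)` that
negates `x_0` and fixes the `x_i` with `i ≠ 0, j` (`exists_algEquiv_flip`); so no atom notices the
change (`exists_finite_realize_iff`). Yet `∏ x_i = ∏ (t - i)` holds on the relation and fails after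
the change. -/

/-! ### Square roots over `k(t)` and sign changes -/

open Polynomial IntermediateField in
/-- In a field generated over `K` by square roots of elements of `K`, every square root of an
element of `K` is, up to a factor in `K`, a product of some of the generators. -/
theorem exists_mul_prod_mem_bot_of_sq_mem_bot {K E ι : Type*} [Field K] [Field E] [Algebra K E]
    [CharZero E] [DecidableEq ι] (s : ι → E) (I : Finset ι)
    (hs : ∀ i ∈ I, s i ^ 2 ∈ (⊥ : IntermediateField K E)) (r : E)
    (hr : r ∈ IntermediateField.adjoin K (s '' I)) (hr2 : r ^ 2 ∈ (⊥ : IntermediateField K E)) :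
    ∃ J ⊆ I, r * ∏ i ∈ J, s i ∈ (⊥ : IntermediateField K E) := by
  induction I using Finset.induction_on generalizing r with
  | empty => exact ⟨∅, subset_rfl, by simpa using hr⟩
  | insert i I hi ih =>
    have hsI : ∀ j ∈ I, s j ^ 2 ∈ (⊥ : IntermediateField K E) :=
      fun j hj => hs j (Finset.mem_insert_of_mem hj)
    have hsi := hs i (Finset.mem_insert_self i I)
    set F := IntermediateField.adjoin K (s '' (I : Set ι)) with hF
    have bot_mem : ∀ {y : E}, y ∈ (⊥ : IntermediateField K E) → y ∈ F :=
      fun hy => bot_le (a := F) hy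
    have of_mem : r ∈ F → ∃ J ⊆ insert i I, r * ∏ l ∈ J, s l ∈ (⊥ : IntermediateField K E) := by
      intro h
      obtain ⟨J, hJ, h⟩ := ih hsI r h hr2
      exact ⟨J, hJ.trans (Finset.subset_insert i I), h⟩
    have halg : ∀ y ∈ s '' (insert i I : Finset ι), IsAlgebraic K y := by
      rintro _ ⟨l, hl, rfl⟩
      obtain ⟨a, ha⟩ := IntermediateField.mem_bot.1 (hs l hl)
      exact (ha ▸ isAlgebraic_algebraMap a : IsAlgebraic K (s l ^ 2)).of_pow two_pos
    have hlin : ∃ x ∈ F, ∃ y ∈ F, r = x + y * s i := by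
      have hr' : r ∈ Algebra.adjoin K (s '' (insert i I : Finset ι)) := by
        rwa [← IntermediateField.adjoin_toSubalgebra_of_isAlgebraic halg]
      clear hr hr2 of_mem
      induction hr' using Algebra.adjoin_induction with
      | mem x hx =>
        obtain ⟨l, hl, rfl⟩ := hx
        rcases Finset.mem_insert.1 hl with rfl | hl
        · exact ⟨0, F.zero_mem, 1, F.one_mem, by ring⟩
        · exact ⟨s l, IntermediateField.subset_adjoin K _ ⟨l, hl, rfl⟩, 0, F.zero_mem, by ring⟩
      | algebraMap a => exact ⟨_, F.algebraMap_mem a, 0, F.zero_mem, by ring⟩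
      | add x y _ _ hx hy =>
        obtain ⟨a, ha, b, hb, rfl⟩ := hx
        obtain ⟨c, hc, d, hd, rfl⟩ := hy
        exact ⟨a + c, F.add_mem ha hc, b + d, F.add_mem hb hd, by ring⟩
      | mul x y _ _ hx hy =>
        obtain ⟨a, ha, b, hb, rfl⟩ := hx
        obtain ⟨c, hc, d, hd, rfl⟩ := hy
        exact ⟨a * c + b * d * s i ^ 2,
          F.add_mem (F.mul_mem ha hc) (F.mul_mem (F.mul_mem hb hd) (bot_mem hsi)),
          a * d + b * c, F.add_mem (F.mul_mem ha hd) (F.mul_mem hb hc), by ring⟩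
    obtain ⟨x, hx, y, hy, hxy⟩ := hlin
    by_cases hx0 : x = 0
    -- Here `r = y * s i`, so multiplying by `s i` descends to `F`, at the cost of adding `i` to
    -- `J`.
    · have hri : r * s i ∈ F := by
        rw [show r * s i = y * s i ^ 2 by rw [hxy, hx0]; ring]
        exact F.mul_mem hy (bot_mem hsi)
      obtain ⟨J, hJ, h⟩ := ih hsI _ hri (by rw [mul_pow]; exact mul_mem hr2 hsi)
      refine ⟨insert i J, Finset.insert_subset_insert i hJ, ?_⟩
      rwa [Finset.prod_insert fun hiJ => hi (hJ hiJ), ← mul_assoc]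
    · by_cases hy0 : y = 0
      · exact of_mem (by rw [hxy, hy0]; simpa using hx)
      -- The cross term of `(x + y * s i) ^ 2` puts `s i`, and hence `r`, in `F`.
      · have hsF : s i = (r ^ 2 - x ^ 2 - y ^ 2 * s i ^ 2) / (2 * x * y) := by
          rw [hxy]; field_simp; ring
        have hsiF : s i ∈ F := by
          rw [hsF]
          exact F.div_mem (F.sub_mem (F.sub_mem (bot_mem hr2) (pow_mem hx 2))
            (F.mul_mem (pow_mem hy 2) (bot_mem hsi)))
            (F.mul_mem (F.mul_mem (ofNat_mem F 2) hx) hy)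
        exact of_mem (by rw [hxy]; exact F.add_mem hx (F.mul_mem hy hsiF))

-- The order of vanishing at `a` is even for a square in `k(t)`, but it is one for `(X - a) H`.
open Polynomial IntermediateField in
theorem sq_ne_of_mem_adjoin_transcendental {k E : Type*} [Field k] [Field E] [Algebra k E] {t : E}
    (ht : Transcendental k t) (a : k) (H : k[X]) (hH : H.eval a ≠ 0) {y : E} (hy : y ∈ k⟮t⟯) :
    y ^ 2 ≠ aeval t ((X - C a) * H) := by
  intro h
  obtain ⟨P, Q, rfl⟩ := (IntermediateField.mem_adjoin_simple_iff k y).1 hy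
  have hH0 : H ≠ 0 := by rintro rfl; simp at hH
  have hXH : (X - C a) * H ≠ 0 := mul_ne_zero (X_sub_C_ne_zero a) hH0
  have inj := transcendental_iff_injective.1 ht
  have hne : ∀ p : k[X], p ≠ 0 → aeval t p ≠ 0 := fun p hp h0 => hp (inj (by simpa using h0))
  have hQ : Q ≠ 0 := by
    rintro rfl
    apply hne _ hXH
    rw [← h]; simp
  have hPQ : P ^ 2 = (X - C a) * H * Q ^ 2 := by
    apply inj
    have := hne Q hQ
    rw [map_mul, ← h, map_pow, map_pow]
    field_simp
  have hP : P ≠ 0 := by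
    rintro rfl
    exact mul_ne_zero hXH (pow_ne_zero 2 hQ) (by rw [← hPQ]; simp)
  have := congrArg (rootMultiplicity a) hPQ
  rw [rootMultiplicity_mul (mul_ne_zero hXH (pow_ne_zero 2 hQ)), rootMultiplicity_mul hXH,
    rootMultiplicity_X_sub_C_self, rootMultiplicity_eq_zero hH, pow_two, pow_two,
    rootMultiplicity_mul (mul_ne_zero hP hP), rootMultiplicity_mul (mul_ne_zero hQ hQ)] at this
  omega

/-- Adding one repeatedly to `0` reaches all of the cycle. With `i` read as the edge from `i` to `i
+ 1`, the vertex `i + 1` found here lies on exactly one edge of `J`. -/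
theorem exists_mem_add_one_notMem {n : ℕ} [NeZero n] (J : Finset (Fin n)) (h0 : 0 ∈ J)
    {j : Fin n} (hj : j ∉ J) : ∃ i ∈ J, i + 1 ∉ J := by
  by_contra! h
  apply hj
  have : ∀ m : ℕ, (Fin.ofNat n m) ∈ J := by
    intro m
    induction m with
    | zero => simpa using h0
    | succ m ih =>
      have := h _ ih
      convert this using 1
      ext
      simp [Fin.val_add]
  simpa using this j

-- The minimal polynomial of `x` is `X² - a`, so `x` and `-x` are conjugate in the normal extension
-- `E`.
open Polynomial in
theorem exists_algEquiv_eq_neg {F E : Type*} [Field F] [Field E] [Algebra F E] [IsAlgClosed E]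
    [Algebra.IsAlgebraic F E] {x : E} (hx : ∀ b : F, algebraMap F E b ≠ x)
    (hx2 : ∃ a : F, algebraMap F E a = x ^ 2) : ∃ σ : E ≃ₐ[F] E, σ x = -x := by
  obtain ⟨a, ha⟩ := hx2
  have hmin : minpoly F x = X ^ 2 - C a := by
    symm
    apply minpoly.eq_of_irreducible_of_monic
    · apply X_pow_sub_C_irreducible_of_prime Nat.prime_two
      intro b h
      have h : algebraMap F E b ^ 2 = x ^ 2 := by rw [← ha, ← h, map_pow]
      rcases sq_eq_sq_iff_eq_or_eq_neg.1 h with h | h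
      · exact hx b h
      · exact hx (-b) (by rw [map_neg, h, neg_neg])
    · simp [ha]
    · exact monic_X_pow_sub_C _ two_ne_zero
  have : Normal F E := ⟨fun y => IsAlgClosed.splits _⟩
  have hconj : IsConjRoot F x (-x) := by
    refine isConjRoot_of_aeval_eq_zero (Algebra.IsIntegral.isIntegral x) ?_
    rw [hmin]
    simp [ha]
  obtain ⟨σ, hσ⟩ := isConjRoot_iff_exists_algEquiv.1 hconj.symm
  exact ⟨σ, hσ⟩

open Polynomial IntermediateField in
/-- Let `t` be transcendental over `k`, and `s i ^ 2 = t - i`. A field automorphism over `k(t)`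
can change the sign of `s 0 * s 1` while fixing all but one of the other cyclic products
`s i * s (i + 1)`. -/
theorem exists_algEquiv_flip {k E : Type*} [Field k] [Field E] [Algebra k E] [CharZero k]
    [IsAlgClosed E] {t : E} (ht : Transcendental k t) [Algebra.IsAlgebraic k⟮t⟯ E]
    {n : ℕ} [NeZero n] (hn : 2 ≤ n) (s : Fin n → E) (hs : ∀ i, s i ^ 2 = t - ((i : ℕ) : E))
    (j : Fin n) (hj : j ≠ 0) :
    ∃ σ : E ≃ₐ[k] E, σ t = t ∧ σ (s 0 * s (0 + 1)) = -(s 0 * s (0 + 1)) ∧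
      ∀ i, i ≠ 0 → i ≠ j → σ (s i * s (i + 1)) = s i * s (i + 1) := by
  have : CharZero E := charZero_of_injective_algebraMap (algebraMap k E).injective
  have htmem : t ∈ k⟮t⟯ := mem_adjoin_simple_self k t
  have hsmem : ∀ i, (s i * s (i + 1)) ^ 2 ∈ (⊥ : IntermediateField k⟮t⟯ E) := by
    intro i
    rw [mul_pow, hs, hs]
    have : ∀ m : ℕ, t - (m : E) ∈ k⟮t⟯ := fun m => sub_mem htmem (_root_.natCast_mem _ m)
    exact IntermediateField.mem_bot.2 ⟨⟨_, mul_mem (this _) (this _)⟩, rfl⟩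
  set I : Finset (Fin n) := {i | i ≠ 0 ∧ i ≠ j} with hI
  set F := IntermediateField.adjoin k⟮t⟯ ((fun i => s i * s (i + 1)) '' (I : Set (Fin n))) with hF
  have hnot : s 0 * s (0 + 1) ∉ F := by
    intro hmem
    obtain ⟨J, hJ, h⟩ := exists_mul_prod_mem_bot_of_sq_mem_bot (K := k⟮t⟯)
      (fun i => s i * s (i + 1)) I (fun i _ => hsmem i) _ hmem (hsmem 0)
    have h0J : 0 ∉ J := fun h => by simpa [hI] using hJ h
    have hjJ : j ∉ J := fun h => by simpa [hI] using hJ h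
    rw [← Finset.prod_insert (f := fun i => s i * s (i + 1)) h0J] at h
    obtain ⟨i, hi, hi1⟩ := exists_mem_add_one_notMem (insert 0 J) (Finset.mem_insert_self 0 J)
      (j := j) (by simp [hj, hjJ])
    set J' := insert 0 J
    obtain ⟨⟨y, hy⟩, hyx⟩ := IntermediateField.mem_bot.1 h
    change y = _ at hyx
    have cast_ne : ∀ {a b : Fin n}, a ≠ b → (((a : ℕ) : k) - ((b : ℕ) : k)) ≠ 0 := by
      intro a b hab
      rw [sub_ne_zero]
      exact fun h => hab (Fin.ext (Nat.cast_injective h))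
    have one_ne : (1 : Fin n) ≠ 0 := by
      intro h
      have := congrArg Fin.val h
      rw [Fin.val_one', Fin.val_zero, Nat.mod_eq_of_lt hn] at this
      omega
    -- The square of the product over `J'` has a simple zero at `t = i + 1`: that factor comes from
    -- `l = i` alone, since `i + 1 ∉ J'`.
    refine sq_ne_of_mem_adjoin_transcendental ht (((i + 1 : Fin n) : ℕ) : k)
      ((X - C ((i : ℕ) : k)) * ∏ l ∈ J'.erase i,
        ((X - C ((l : ℕ) : k)) * (X - C (((l + 1 : Fin n) : ℕ) : k)))) ?_ hy ?_
    · simp only [eval_mul, eval_prod, eval_sub, eval_X, eval_C]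
      refine mul_ne_zero (cast_ne (by simpa using one_ne))
        (Finset.prod_ne_zero_iff.2 fun l hl => ?_)
      rw [Finset.mem_erase] at hl
      refine mul_ne_zero (cast_ne ?_) (cast_ne ?_)
      · rintro rfl; exact hi1 hl.2
      · intro h; exact hl.1 (add_right_cancel h).symm
    · rw [hyx, ← Finset.mul_prod_erase _ _ hi, mul_pow, ← Finset.prod_pow]
      simp only [mul_pow, hs, map_mul, map_prod, map_sub, aeval_X, map_natCast]
      ring
  have : Algebra.IsAlgebraic F E := Algebra.IsAlgebraic.tower_top (K := k⟮t⟯) F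
  have hx2 : (s 0 * s (0 + 1)) ^ 2 ∈ F := bot_le (a := F) (hsmem 0)
  obtain ⟨σ, hσ⟩ := exists_algEquiv_eq_neg (F := F) (x := s 0 * s (0 + 1))
    (fun b hb => hnot (hb ▸ b.2)) ⟨⟨_, hx2⟩, rfl⟩
  have hfix : ∀ y ∈ F, σ y = y := fun y hy => σ.commutes ⟨y, hy⟩
  refine ⟨{ σ.toRingEquiv with commutes' := fun a => hfix _ ?_ }, hfix _ ?_, hσ,
    fun i h0 hij => hfix _ (subset_adjoin _ _ ⟨i, by simp [hI, h0, hij], rfl⟩)⟩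
  · exact F.algebraMap_mem (algebraMap k k⟮t⟯ a)
  · exact F.algebraMap_mem ⟨t, htmem⟩

/-! ### Transcendence bases of `ℂ` -/

theorem IsTranscendenceBasis.exists_intermediateField {F E : Type*} [Field F] [Field E]
    [Algebra F E] {B : Set E} (hB : IsTranscendenceBasis F ((↑) : B → E)) (t : B) :
    ∃ k : IntermediateField F E, Transcendental k (t : E) ∧
      Algebra.IsAlgebraic (IntermediateField.adjoin k {(t : E)}) E := by
  set k := IntermediateField.adjoin F (B \ {(t : E)})
  refine ⟨k, ?_, ?_⟩
  · have := hB.1.transcendental_adjoin (s := {t}ᶜ) (i := t) (by simp)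
    have himage : (Subtype.val '' ({t}ᶜ : Set B)) = B \ {(t : E)} := by
      ext x; simp
    rw [himage] at this
    exact IntermediateField.transcendental_adjoin_iff.2 this
  · have := hB.isAlgebraic_field
    rw [Subtype.range_coe] at this
    have hle : IntermediateField.adjoin F B ≤
        (IntermediateField.adjoin k {(t : E)}).restrictScalars F := by
      rw [IntermediateField.adjoin_le_iff]
      intro b hb
      by_cases hbt : b = t
      · exact hbt ▸ IntermediateField.mem_adjoin_simple_self k (t : E)
      · exact (IntermediateField.adjoin k {(t : E)}).algebraMap_mem
          ⟨b, IntermediateField.subset_adjoin F _ ⟨hb, hbt⟩⟩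
    let : Algebra (IntermediateField.adjoin F B) (IntermediateField.adjoin k {(t : E)}) :=
      (IntermediateField.inclusion hle).toRingHom.toAlgebra
    have : IsScalarTower (IntermediateField.adjoin F B) (IntermediateField.adjoin k {(t : E)}) E :=
      IsScalarTower.of_algebraMap_eq (congrFun rfl)
    exact Algebra.IsAlgebraic.extendScalars (R := IntermediateField.adjoin F B)
      (IntermediateField.inclusion hle).injective

/-- For a countable set `A` of complex numbers, there are a field `k ⊇ A` and a complex number `t`
that is a transcendence basis of the field of complex numbers over `k`. -/
theorem exists_transcendental_over_subfield (A : Set ℂ) (hA : A.Countable) :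
    ∃ (k : Type) (_ : Field k) (_ : Algebra k ℂ) (t : ℂ), A ⊆ Set.range (algebraMap k ℂ) ∧
      Transcendental k t ∧ Algebra.IsAlgebraic (IntermediateField.adjoin k {t}) ℂ := by
  have hcard : Cardinal.mk (Subfield.closure A) ≤ Cardinal.aleph0 := by
    have := hA.to_subtype
    exact (Subfield.cardinalMk_closure_le_max A).trans (max_le (Cardinal.mk_le_aleph0) le_rfl)
  -- An algebraic extension of a countable field is countable.
  have htr : Algebra.Transcendental (Subfield.closure A) ℂ := by
    rw [Algebra.transcendental_iff_not_isAlgebraic]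
    intro h
    have := (Algebra.IsAlgebraic.cardinalMk_le_max (Subfield.closure A) ℂ).trans
      (max_le hcard le_rfl)
    rw [Cardinal.mk_complex] at this
    exact absurd this (not_le.2 Cardinal.aleph0_lt_continuum)
  obtain ⟨B, hB⟩ := exists_isTranscendenceBasis (Subfield.closure A) ℂ
  obtain ⟨t⟩ := hB.nonempty_iff_transcendental.2 htr
  obtain ⟨k, hk, hk'⟩ := hB.exists_intermediateField t
  exact ⟨k, inferInstance, inferInstance, t, fun a ha =>
    ⟨algebraMap (Subfield.closure A) k ⟨a, Subfield.subset_closure ha⟩, rfl⟩, hk, hk'⟩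

/-! ### Function graphs as curves, and invariance of quantifier-free formulas -/

open FirstOrder FirstOrder.Language

/-- A definable binary relation that is the graph of a partial function is a curve. -/
theorem isCurve_of_functional {L : FirstOrder.Language.{u, u}} {M : Type u} [L.Structure M]
    {A : Set M} {X : Set (Fin 2 → M)} (hX : A.Definable L X)
    (h : ∀ v ∈ X, ∀ w ∈ X, v 0 = w 0 → v 1 = w 1) : IsCurve L A X := by
  refine ⟨hX, sSup_le ?_⟩
  rintro _ ⟨d, ⟨φ, rfl, N, _, f, a, ha, i, hi⟩, rfl⟩
  suffices d ≤ 1 by exact_mod_cast this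
  by_contra! hd
  have hd2 : d ≤ 2 := by simpa using Fintype.card_le_of_injective i i.injective
  obtain rfl : d = 2 := by omega
  have h01 : i 0 < i 1 := i.strictMono (by decide)
  have hi0 : i 0 = 0 := by omega
  have hi1 : i 1 = 1 := by omega
  -- Uniqueness of the value is first-order, so it passes to `N`; there `a 1` is the only point of
  -- its fibre, hence algebraic over `M` and `a 0`.
  let θ : L.Formula (M ⊕ Fin 3) :=
    φ.relabel (Sum.map id ![0, 1]) ⟹ φ.relabel (Sum.map id ![0, 2]) ⟹
      (Term.var (Sum.inr 1)).equal (Term.var (Sum.inr 2))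
  have hθ : ∀ {K : Type u} [L.Structure K] (g : M → K) (u : Fin 3 → K),
      θ.Realize (Sum.elim g u) ↔ (φ.Realize (Sum.elim g ![u 0, u 1]) →
        φ.Realize (Sum.elim g ![u 0, u 2]) → u 1 = u 2) := by
    intro K _ g u
    have e : ∀ p q : Fin 3, Sum.elim g u ∘ Sum.map id ![p, q] = Sum.elim g ![u p, u q] := by
      intro p q
      ext (m | m)
      · rfl
      · fin_cases m <;> rfl
    simp only [θ, Formula.realize_imp, Formula.realize_relabel, Formula.realize_equal, e,
      Term.realize_var, Sum.elim_inr]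
  have hM : (θ.iAlls (Fin 3)).Realize (id : M → M) := by
    rw [Formula.realize_iAlls]
    intro u
    exact (hθ id u).2 fun h1 h2 => h _ h1 _ h2 rfl
  have hN : (θ.iAlls (Fin 3)).Realize f := by
    simpa using (f.map_formula (θ.iAlls (Fin 3)) id).2 hM
  have hN : ∀ y z, φ.Realize (Sum.elim f ![a 0, y]) → φ.Realize (Sum.elim f ![a 0, z]) →
      y = z := by
    intro y z
    rw [Formula.realize_iAlls] at hN
    exact (hθ f ![a 0, y, z]).1 (hN ![a 0, y, z])
  apply hi 1
  rw [hi1]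
  have haa : ![a 0, a 1] = a := by ext m; fin_cases m <;> rfl
  refine ⟨{y | φ.Realize (Sum.elim f ![a 0, y])}, ?_, ?_, ?_⟩
  · rw [Set.Definable₁, Set.definable_iff_exists_formula_sum]
    refine ⟨φ.relabel (Sum.elim (fun m => Sum.inl ⟨f m, Or.inl ⟨m, rfl⟩⟩)
      ![Sum.inl ⟨a (i 0), Or.inr ⟨0, by decide, rfl⟩⟩, Sum.inr 0]), ?_⟩
    ext v
    simp only [Set.mem_ofPred_eq, Formula.realize_relabel]
    congr! 1
    ext (m | m)
    · rfl
    · fin_cases m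
      · simp [hi0]
      · rfl
  · exact Set.Subsingleton.finite fun y hy z hz => hN y z hy hz
  · simpa [haa] using ha

theorem definable_zeroLocus_freeCommRing {R α : Type*} [CommRing R]
    [FirstOrder.Ring.CompatibleRing R] (A : Set R) (p : FreeCommRing α) :
    A.Definable FirstOrder.Language.ring {v : α → R | FreeCommRing.lift v p = 0} := by
  refine Set.Definable.mono ?_ (Set.empty_subset A)
  rw [Set.empty_definable_iff]
  refine ⟨(FirstOrder.Ring.termOfFreeCommRing p).equal (FirstOrder.Ring.termOfFreeCommRing 0), ?_⟩
  ext v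
  simp [Formula.realize_equal]

/-- Truth in the structure of curves is invariant under coordinatewise application of field
automorphisms that may depend on the atomic subformula. -/
theorem exists_finite_realize_iff {n : ℕ} (hn : 2 ≤ n) {α : Type*} [DecidableEq α]
    (φ : (complexCurves n).Formula ((Set.univ : Set ℂ) ⊕ α)) (hφ : φ.IsQF) :
    ∃ A : Set ℂ, A.Finite ∧ ∀ v v' : α → ℂ,
      (∀ S : Finset α, S.card ≤ n → ∃ σ : ℂ ≃+* ℂ, (∀ a ∈ A, σ a = a) ∧ ∀ i ∈ S, σ (v i) = v' i) →
      (φ.Realize (Sum.elim (fun x : (Set.univ : Set ℂ) => (x : ℂ)) v) ↔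
        φ.Realize (Sum.elim (fun x : (Set.univ : Set ℂ) => (x : ℂ)) v')) := by
  classical
  let f : ↥(Set.univ : Set ℂ) → ℂ := fun x => x
  -- Without function symbols, a term is a parameter or a single variable.
  have hterm : ∀ (e : Fin 0 → ℂ) (τ : (complexCurves n).Term (((Set.univ : Set ℂ) ⊕ α) ⊕ Fin 0)),
      ∃ S : Finset α, S.card ≤ 1 ∧ ∃ A : Set ℂ, A.Finite ∧ ∀ (v v' : α → ℂ) (σ : ℂ ≃+* ℂ),
        (∀ a ∈ A, σ a = a) → (∀ i ∈ S, σ (v i) = v' i) →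
        τ.realize (Sum.elim (Sum.elim f v') e) =
          σ (τ.realize (Sum.elim (Sum.elim f v) e)) := by
    rintro e (((c | i) | i) | ⟨g, _⟩)
    · exact ⟨∅, by simp, {(c : ℂ)}, Set.finite_singleton _, fun v v' σ h _ => (h _ rfl).symm⟩
    · exact ⟨{i}, by simp, ∅, Set.finite_empty, fun v v' σ _ h => (h i (by simp)).symm⟩
    · exact i.elim0
    · exact g.elim
  suffices h : ∀ (e : Fin 0 → ℂ)
      (ψ : (complexCurves n).BoundedFormula ((Set.univ : Set ℂ) ⊕ α) 0), ψ.IsQF →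
      ∃ A : Set ℂ, A.Finite ∧ ∀ v v' : α → ℂ,
        (∀ S : Finset α, S.card ≤ n → ∃ σ : ℂ ≃+* ℂ, (∀ a ∈ A, σ a = a) ∧
          ∀ i ∈ S, σ (v i) = v' i) →
        (ψ.Realize (Sum.elim f v) e ↔ ψ.Realize (Sum.elim f v') e) from
    h _ φ hφ
  intro e ψ hψ
  induction hψ with
  | falsum => exact ⟨∅, Set.finite_empty, fun v v' _ => Iff.rfl⟩
  | of_isAtomic h =>
    cases h with
    | equal τ₁ τ₂ =>
      obtain ⟨S₁, hS₁, A₁, hA₁, h₁⟩ := hterm e τ₁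
      obtain ⟨S₂, hS₂, A₂, hA₂, h₂⟩ := hterm e τ₂
      refine ⟨A₁ ∪ A₂, hA₁.union hA₂, fun v v' h => ?_⟩
      obtain ⟨σ, hσA, hσ⟩ := h (S₁ ∪ S₂) ((Finset.card_union_le _ _).trans (by omega))
      rw [BoundedFormula.realize_bdEqual, BoundedFormula.realize_bdEqual,
        h₁ v v' σ (fun a ha => hσA a (Or.inl ha)) fun i hi => hσ i (Finset.mem_union_left _ hi),
        h₂ v v' σ (fun a ha => hσA a (Or.inr ha)) fun i hi => hσ i (Finset.mem_union_right _ hi),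
        σ.injective.eq_iff]
    | @rel l R ts =>
      obtain ⟨X, hl, hX, -⟩ := R
      choose S hS A hA hSA using fun j => hterm e (ts j)
      -- The curve itself hides parameters, finitely many, which `σ` must fix too.
      obtain ⟨A₀, -, hA₀⟩ := Set.definable_iff_finitely_definable.1 hX
      rw [Set.definable_iff_exists_formula_sum] at hA₀
      obtain ⟨χ, hχ⟩ := hA₀
      have hχ : ∀ u, u ∈ X ↔ χ.Realize (Sum.elim (↑) u) := fun u => Set.ext_iff.1 hχ u
      refine ⟨A₀ ∪ ⋃ j, A j, A₀.finite_toSet.union (Set.finite_iUnion hA), fun v v' h => ?_⟩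
      obtain ⟨σ, hσA, hσ⟩ := h (Finset.univ.biUnion S)
        ((Finset.card_biUnion_le_card_mul _ _ 1 fun j _ => hS j).trans (by simpa using hl))
      change (fun j => (ts j).realize (Sum.elim (Sum.elim f v) e)) ∈ X ↔
        (fun j => (ts j).realize (Sum.elim (Sum.elim f v') e)) ∈ X
      rw [hχ, hχ, ← StrongHomClass.realize_formula
        (FirstOrder.Ring.languageEquivEquivRingEquiv.symm σ) χ]
      congr! 1
      ext (a | j)
      · exact hσA a (Or.inl a.2)
      · exact (hSA j v v' σ (fun a ha => hσA a (Or.inr (Set.mem_iUnion.2 ⟨j, ha⟩)))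
          fun i hi => hσ i (Finset.mem_biUnion.2 ⟨j, Finset.mem_univ j, hi⟩)).symm
  | imp _ _ ih₁ ih₂ =>
    obtain ⟨A₁, hA₁, h₁⟩ := ih₁
    obtain ⟨A₂, hA₂, h₂⟩ := ih₂
    refine ⟨A₁ ∪ A₂, hA₁.union hA₂, fun v v' h => ?_⟩
    rw [BoundedFormula.realize_imp, BoundedFormula.realize_imp, h₁ v v' ?_, h₂ v v' ?_]
    · intro S hS
      obtain ⟨σ, hσ, h⟩ := h S hS
      exact ⟨σ, fun a ha => hσ a (Or.inr ha), h⟩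
    · intro S hS
      obtain ⟨σ, hσ, h⟩ := h S hS
      exact ⟨σ, fun a ha => hσ a (Or.inl ha), h⟩

theorem definable_of_functional_freeCommRing {β : Type*} (p : FreeCommRing (Fin 2))
    (P : ℂ → ℂ → Prop) (hp : ∀ x y, P x y ↔ FreeCommRing.lift ![x, y] p = 0)
    (hP : ∀ x y z, P x y → P x z → y = z) (i j : β) :
    (∅ : Set ℂ).Definable (algebraicCurves 2) {v : β → ℂ | P (v i) (v j)} := by
  have hp' : ∀ v : Fin 2 → ℂ, FreeCommRing.lift v p = 0 ↔ P (v 0) (v 1) := by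
    intro v
    rw [hp]
    congr! 2
    ext m; fin_cases m <;> rfl
  let R : (algebraicCurves 2).Relations 2 := ⟨{v : Fin 2 → ℂ | FreeCommRing.lift v p = 0}, le_rfl,
    isCurve_of_functional (definable_zeroLocus_freeCommRing _ p) fun v hv w hw h =>
      hP (v 0) _ _ ((hp' v).1 hv) (h ▸ (hp' w).1 hw)⟩
  rw [Set.empty_definable_iff]
  refine ⟨R.formula₂ (Term.var i) (Term.var j), ?_⟩
  ext v
  rw [Set.mem_ofPred_eq, Set.mem_ofPred_eq, Formula.realize_rel₂]
  exact hp _ _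

/-! ### The relation of cyclic root products -/

/-- Take `w = s + s'`; then `s - s' = c / w`, and `s`, `s'`, `s * s'` are rational functions of `w`.
This trades ternary multiplication for binary relations. -/
theorem exists_sum_eq_mul_iff {c s s' x : ℂ} (hc : c ≠ 0) (hs : s ^ 2 - s' ^ 2 = c) :
    (∃ w, 2 * w * s = w ^ 2 + c ∧ 2 * w * s' = w ^ 2 - c ∧ 4 * w ^ 2 * x = w ^ 4 - c ^ 2) ↔
      x = s * s' := by
  constructor
  · rintro ⟨w, h1, h2, h3⟩
    have hw : w ≠ 0 := by
      rintro rfl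
      exact hc (by linear_combination -h1)
    have : 4 * w ^ 2 ≠ 0 := mul_ne_zero (by norm_num) (pow_ne_zero 2 hw)
    apply mul_left_cancel₀ this
    linear_combination h3 - 2 * w * s' * h1 - (w ^ 2 + c) * h2
  · rintro rfl
    exact ⟨s + s', by linear_combination hs, by linear_combination -hs, by
      rw [← hs]; ring⟩

/-- The cyclic products `√(t - i) * √(t - (i + 1))`, with the indices `i` in `Fin n`, as a
relation between `t` and these products. -/
def cyclicRootProducts (n : ℕ) [NeZero n] : Set (Fin (n + 1) → ℂ) :=
  {v | ∃ s : Fin n → ℂ, (∀ i, s i ^ 2 + ((i : ℕ) : ℂ) = v 0) ∧ ∀ i, v i.succ = s i * s (i + 1)}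

theorem Fin.natCast_add_one_sub_ne_zero {n : ℕ} [NeZero n] (hn : 2 ≤ n) (i : Fin n) :
    ((((i + 1 : Fin n) : ℕ) : ℤ) - ((i : ℕ) : ℤ)) ≠ 0 := by
  rw [sub_ne_zero]
  intro h
  have h : i + 1 = i := Fin.ext (by exact_mod_cast h)
  have := congrArg Fin.val (add_eq_left.1 h)
  rw [Fin.val_one', Fin.val_zero, Nat.mod_eq_of_lt hn] at this
  omega

theorem definable_cyclicRootProducts {n : ℕ} [NeZero n] (hn : 2 ≤ n) :
    (∅ : Set ℂ).Definable (algebraicCurves 2) (cyclicRootProducts n) := by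
  let c : Fin n → ℤ := fun i => (((i + 1 : Fin n) : ℕ) : ℤ) - ((i : ℕ) : ℤ)
  have hc : ∀ i, (c i : ℂ) ≠ 0 := fun i => by
    exact Int.cast_ne_zero.2 <| Fin.natCast_add_one_sub_ne_zero hn i
  let X : Fin 2 → FreeCommRing (Fin 2) := FreeCommRing.of
  have ne_zero : ∀ {i w y}, 2 * w * y = w ^ 2 + (c i : ℂ) ∨ 2 * w * y = w ^ 2 - (c i : ℂ) ∨
      4 * w ^ 2 * y = w ^ 4 - (c i : ℂ) ^ 2 → w ≠ 0 := by
    rintro i w y h rfl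
    apply hc i
    rcases h with h | h | h
    · linear_combination -h
    · linear_combination h
    · exact pow_eq_zero_iff two_ne_zero |>.1 (by linear_combination h)
  -- The quantified variables are the roots `s i` and the sums `w i`.
  let V := Fin (n + 1) ⊕ (Fin n ⊕ Fin n)
  have h1 : ∀ i : Fin n, (∅ : Set ℂ).Definable (algebraicCurves 2)
      {v : V → ℂ | v (.inr (.inl i)) ^ 2 + ((i : ℕ) : ℂ) = v (.inl 0)} := fun i =>
    definable_of_functional_freeCommRing (X 0 ^ 2 + ((i : ℕ) : FreeCommRing (Fin 2)) - X 1)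
      (fun s t => s ^ 2 + ((i : ℕ) : ℂ) = t) (fun s t => by simp [X, sub_eq_zero])
      (fun s t t' h h' => h.symm.trans h') _ _
  have h2 : ∀ i : Fin n, (∅ : Set ℂ).Definable (algebraicCurves 2)
      {v : V → ℂ | 2 * v (.inr (.inr i)) * v (.inr (.inl i)) = v (.inr (.inr i)) ^ 2 + (c i : ℂ)} :=
    fun i => definable_of_functional_freeCommRing
      (2 * X 0 * X 1 - (X 0 ^ 2 + (c i : FreeCommRing (Fin 2))))
      (fun w s => 2 * w * s = w ^ 2 + (c i : ℂ)) (fun w s => by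
        simp [X, sub_eq_zero, map_ofNat (FreeCommRing.lift ![w, s])])
      (fun w s s' h h' => mul_left_cancel₀ (mul_ne_zero two_ne_zero (ne_zero (.inl h)))
        (h.trans h'.symm)) _ _
  have h3 : ∀ i : Fin n, (∅ : Set ℂ).Definable (algebraicCurves 2)
      {v : V → ℂ | 2 * v (.inr (.inr i)) * v (.inr (.inl (i + 1))) =
        v (.inr (.inr i)) ^ 2 - (c i : ℂ)} :=
    fun i => definable_of_functional_freeCommRing
      (2 * X 0 * X 1 - (X 0 ^ 2 - (c i : FreeCommRing (Fin 2))))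
      (fun w s => 2 * w * s = w ^ 2 - (c i : ℂ)) (fun w s => by
        simp [X, sub_eq_zero, map_ofNat (FreeCommRing.lift ![w, s])])
      (fun w s s' h h' => mul_left_cancel₀ (mul_ne_zero two_ne_zero (ne_zero (.inr (.inl h))))
        (h.trans h'.symm)) _ _
  have h4 : ∀ i : Fin n, (∅ : Set ℂ).Definable (algebraicCurves 2)
      {v : V → ℂ | 4 * v (.inr (.inr i)) ^ 2 * v (.inl i.succ) =
        v (.inr (.inr i)) ^ 4 - (c i : ℂ) ^ 2} :=
    fun i => definable_of_functional_freeCommRing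
      (4 * X 0 ^ 2 * X 1 - (X 0 ^ 4 - (c i : FreeCommRing (Fin 2)) ^ 2))
      (fun w x => 4 * w ^ 2 * x = w ^ 4 - (c i : ℂ) ^ 2) (fun w s => by
        simp [X, sub_eq_zero, map_ofNat (FreeCommRing.lift ![w, s])])
      (fun w s s' h h' => mul_left_cancel₀
        (mul_ne_zero (by norm_num) (pow_ne_zero 2 (ne_zero (.inr (.inr h))))) (h.trans h'.symm)) _ _
  convert (Set.definable_iInter_of_finite fun i =>
    (h1 i).inter ((h2 i).inter ((h3 i).inter (h4 i)))).exists_of_finite using 1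
  ext v
  simp only [cyclicRootProducts, Set.mem_ofPred_eq, Set.mem_iInter, Set.mem_inter_iff]
  have key : ∀ s : Fin n → ℂ, (∀ i, s i ^ 2 + ((i : ℕ) : ℂ) = v 0) → ∀ i,
      s i ^ 2 - s (i + 1) ^ 2 = (c i : ℂ) := by
    intro s hs i
    simp only [c, Int.cast_sub, Int.cast_natCast]
    linear_combination hs i - hs (i + 1)
  constructor
  · rintro ⟨s, hs, hx⟩
    choose w hw using fun i => (exists_sum_eq_mul_iff (hc i) (key s hs i)).2 (hx i)
    exact ⟨Sum.elim s w, fun i => ⟨hs i, hw i⟩⟩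
  · rintro ⟨u, hu⟩
    have hs : ∀ i, u (.inl i) ^ 2 + ((i : ℕ) : ℂ) = v 0 := fun i => (hu i).1
    exact ⟨fun i => u (.inl i), hs, fun i =>
      (exists_sum_eq_mul_iff (hc i) (key (fun i => u (.inl i)) hs i)).1 ⟨_, (hu i).2⟩⟩

/-- Around the cycle each root occurs in two factors, so the choice of signs cancels. -/
theorem prod_eq_of_mem_cyclicRootProducts {n : ℕ} [NeZero n] {v : Fin (n + 1) → ℂ}
    (hv : v ∈ cyclicRootProducts n) :
    ∏ i : Fin n, v i.succ = ∏ i : Fin n, (v 0 - ((i : ℕ) : ℂ)) := by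
  obtain ⟨s, hs, hx⟩ := hv
  simp only [hx, Finset.prod_mul_distrib]
  rw [show ∏ i, s (i + 1) = ∏ i, s i from Equiv.prod_comp (Equiv.addRight (1 : Fin n)) s,
    ← Finset.prod_mul_distrib]
  exact Finset.prod_congr rfl fun i _ => by linear_combination hs i

theorem not_qfDefinable_cyclicRootProducts {n : ℕ} [NeZero n] (hn : 3 ≤ n) :
    ¬ QFDefinable (Set.univ : Set ℂ) (complexCurves (n - 1)) (cyclicRootProducts n) := by
  rintro ⟨φ, hφ, hT⟩
  obtain ⟨A, hA, h⟩ := exists_finite_realize_iff (by omega) φ hφ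
  obtain ⟨k, _, _, t, hAk, ht, _⟩ := exists_transcendental_over_subfield A hA.countable
  have : CharZero k := (algebraMap k ℂ).charZero
  choose s hs using fun i : Fin n => IsAlgClosed.exists_pow_nat_eq (t - ((i : ℕ) : ℂ)) two_pos
  let x : Fin n → ℂ := fun i => s i * s (i + 1)
  have hmem : (Fin.cons t x : Fin (n + 1) → ℂ) ∈ cyclicRootProducts n :=
    ⟨s, fun i => by simp [hs], fun i => rfl⟩
  have hmem' : (Fin.cons t (Function.update x 0 (-x 0)) : Fin (n + 1) → ℂ) ∈
      cyclicRootProducts n := by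
    rw [hT] at hmem ⊢
    refine (h _ _ fun S hS => ?_).1 hmem
    -- At most `n - 1` coordinates are seen, and there are `n` products.
    obtain ⟨j, hj⟩ : ∃ j : Fin n, j.succ ∉ S := by
      by_contra! hall
      have := Finset.card_le_card (show Finset.univ.map (Fin.succEmb n) ⊆ S by
        intro i hi
        obtain ⟨j, -, rfl⟩ := Finset.mem_map.1 hi
        exact hall j)
      rw [Finset.card_map, Finset.card_univ, Fintype.card_fin] at this
      omega
    by_cases hj0 : j = 0
    · subst hj0
      refine ⟨RingEquiv.refl ℂ, fun _ _ => rfl, fun i hi => ?_⟩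
      induction i using Fin.cases with
      | zero => rfl
      | succ i =>
        have : i ≠ 0 := by rintro rfl; exact hj hi
        simp [this]
    · obtain ⟨σ, hσt, hσ0, hσ⟩ := exists_algEquiv_flip ht (by omega) s hs j hj0
      refine ⟨σ.toRingEquiv, fun a ha => ?_, fun i hi => ?_⟩
      · obtain ⟨b, rfl⟩ := hAk ha
        exact σ.commutes b
      · induction i using Fin.cases with
        | zero => exact hσt
        | succ i =>
          have hij : i ≠ j := by rintro rfl; exact hj hi
          by_cases hi0 : i = 0
          · subst hi0
            simp only [Fin.cons_succ, Function.update_self]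
            exact hσ0
          · simpa [x, hi0] using hσ i hi0 hij
  have e := prod_eq_of_mem_cyclicRootProducts hmem
  have e' := prod_eq_of_mem_cyclicRootProducts hmem'
  simp only [Fin.cons_succ, Fin.cons_zero] at e e'
  -- The product equals its own negative, so it vanishes and `t` is a natural number.
  rw [Finset.prod_update_of_mem (Finset.mem_univ _), neg_mul, ← e,
    ← Finset.mul_prod_erase _ _ (Finset.mem_univ (0 : Fin n)), Finset.sdiff_singleton_eq_erase,
    neg_eq_self, Finset.mul_prod_erase _ _ (Finset.mem_univ (0 : Fin n)), e,
    Finset.prod_eq_zero_iff] at e'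
  obtain ⟨i, -, hi⟩ := e'
  rw [sub_eq_zero] at hi
  apply ht
  rw [hi, ← map_natCast (algebraMap k ℂ)]
  exact isAlgebraic_algebraMap _

/-! ### Enlarging the language, and failure of quantifier elimination -/

/-- The inclusion of the language of the curves definable over `A` into that of the curves
definable over a larger set. -/
def curveLanguageInclusion (L : FirstOrder.Language.{u, u}) {M : Type u} [L.Structure M]
    {A B : Set M} (hAB : A ⊆ B) {m n : ℕ} (hmn : m ≤ n) :
    curveLanguage L A m →ᴸ curveLanguage L B n where
  onFunction _ f := f
  onRelation _ r := ⟨r.1, r.2.1.trans hmn, r.2.2.1.mono hAB, r.2.2.2⟩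

instance curveLanguageInclusion_isExpansionOn (L : FirstOrder.Language.{u, u}) {M : Type u}
    [L.Structure M] {A B : Set M} (hAB : A ⊆ B) {m n : ℕ} (hmn : m ≤ n) :
    (curveLanguageInclusion L hAB hmn).IsExpansionOn M where
  map_onFunction f _ := f.elim
  map_onRelation _ _ := rfl

theorem proposition5p1 :
    (∀ n : ℕ, 3 ≤ n → ∃ T : Set (Fin (n + 1) → ℂ),
      (∅ : Set ℂ).Definable (algebraicCurves 2) T ∧
        ¬ QFDefinable (Set.univ : Set ℂ) (complexCurves (n - 1)) T) ∧
    (∀ n : ℕ, 2 ≤ n → ¬ HasQuantifierElimination (complexCurves n) ℂ) := by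
  have main : ∀ n : ℕ, 3 ≤ n → ∃ T : Set (Fin (n + 1) → ℂ),
      (∅ : Set ℂ).Definable (algebraicCurves 2) T ∧
        ¬ QFDefinable (Set.univ : Set ℂ) (complexCurves (n - 1)) T := by
    intro n hn
    have : NeZero n := ⟨by omega⟩
    exact ⟨cyclicRootProducts n, definable_cyclicRootProducts (by omega),
      not_qfDefinable_cyclicRootProducts hn⟩
  refine ⟨main, fun n hn hQE => ?_⟩
  obtain ⟨T, hT, hnot⟩ := main (n + 1) (by omega)
  have hT' : (∅ : Set ℂ).Definable (complexCurves n) T :=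
    hT.map_expansion (curveLanguageInclusion FirstOrder.Language.ring (Set.subset_univ _) hn)
  obtain ⟨φ, rfl⟩ := Set.empty_definable_iff.1 hT'
  obtain ⟨ψ, hψ, hφψ⟩ := hQE _ φ
  refine hnot ⟨ψ.relabel Sum.inr, hψ.relabel _, ?_⟩
  ext v
  simp only [Set.mem_ofPred_eq, Formula.realize_relabel, Sum.elim_comp_inr]
  exact hφψ v
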